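/- Let $R$ be a commutative ring with identity (not necessarily Noetherian) and let $M$ be a finitely generated $R$-module. For a finite sequence $\underline{x}=x_1,\dots,x_r$ in $R$ with Koszul complex $\mathbb{K}_\bullet(\underline{x})$, the Koszul grade of $\underline{x}$ on $M$ is $\inf\{i\ge 0 : H^i(\operatorname{Hom}_R(\mathbb{K}_\bullet(\underline{x}),M))\neq 0\}$ (with $\inf\emptyset=+\infty$); it depends only on the ideal generated by $\underline{x}$. For an ideal $\mathfrak{a}$ of $R$, the Koszul grade $\operatorname{K.grade}_R(\mathfrak{a},M)$ is the supremum of the Koszul grades on $M$ of the finite sequences of elements of $\mathfrak{a}$, that is, of the Koszul grades of the finitely generated ideals contained in $\mathfrak{a}$. The $M$-height of $\mathfrak{a}$ is $\operatorname{ht}_M(\mathfrak{a})=\inf\{\dim M_{\mathfrak{p}} : \mathfrak{p}\in\operatorname{Supp}_R(M),\ \mathfrak{a}\subseteq\mathfrak{p}\}$ (with $\inf\emptyset=+\infty$), where $\dim M_{\mathfrak p}$ is the supremum of the lengths of chains of primes in $\operatorname{Supp}_R(M)$ with largest member $\mathfrak p$. Consider the following conditions: (i) $\operatorname{ht}_M(\mathfrak{p})=\operatorname{K.grade}_R(\mathfrak{p},M)$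 for all prime ideals $\mathfrak{p}\in\operatorname{Supp}_R(M)$. (ii) $\operatorname{ht}_M(\mathfrak{a})=\operatorname{K.grade}_R(\mathfrak{a},M)$ for all ideals $\mathfrak{a}$ of $R$. (iii) $\operatorname{ht}_M(\mathfrak{q})=\operatorname{K.grade}_{R_{\mathfrak{p}}}(\mathfrak{q}R_{\mathfrak{p}},M_{\mathfrak{p}})$ for all prime ideals $\mathfrak{p},\mathfrak{q}\in\operatorname{Supp}_R(M)$ with $\mathfrak{q}\subseteq\mathfrak{p}$. (iv) $\operatorname{ht}_M(\mathfrak{p})=\operatorname{K.grade}_{R_{\mathfrak{p}}}(\mathfrak{p}R_{\mathfrak{p}},M_{\mathfrak{p}})$ for all prime ideals $\mathfrak{p}\in\operatorname{Supp}_R(M)$. (v) $\operatorname{ht}_M(\mathfrak{a})=\operatorname{K.grade}_R(\mathfrak{a},M)$ for all finitely generated ideals $\mathfrak{a}$ of $R$. Then $(i)\Leftrightarrow(ii)\Rightarrow(iii)\Rightarrow(iv)\Rightarrow(v)$. -/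

import Mathlib

universe u v

noncomputable section

section Koszul

variable {R : Type u} [CommRing R] {r : ℕ}

/-- The linear form `R ^ r → R`, `e_j ↦ x_j`. -/
def koszulForm (x : Fin r → R) : (Fin r → R) →ₗ[R] R :=
  Fintype.linearCombination R x

/-- The differential `⋀^(n+1) R^r → ⋀^n R^r` of the Koszul complex `K_•(x)`:
`v_0 ∧ ⋯ ∧ v_n ↦ ∑ j, (-1)^j φ(v_j) v_0 ∧ ⋯ ∧ v̂_j ∧ ⋯ ∧ v_n`, where `φ(e_j) = x_j`. -/
def koszulDifferential (x : Fin r → R) (n : ℕ) :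
    ⋀[R]^(n + 1) (Fin r → R) →ₗ[R] ⋀[R]^n (Fin r → R) :=
  exteriorPower.alternatingMapLinearEquiv
    (AlternatingMap.alternatizeUncurryFin
      ((koszulForm x).smulRight (exteriorPower.ιMulti R n (M := Fin r → R))))

theorem koszulDifferential_ιMulti (x : Fin r → R) (n : ℕ) (w : Fin (n + 1) → Fin r → R) :
    koszulDifferential x n (exteriorPower.ιMulti R (n + 1) w) =
      ∑ j : Fin (n + 1), (-1 : ℤ) ^ (j : ℕ) •
        (koszulForm x (w j) • exteriorPower.ιMulti R n (j.removeNth w)) := by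
  simp [koszulDifferential, AlternatingMap.alternatizeUncurryFin_apply]

/-- The Koszul differentials form a complex. -/
theorem koszulDifferential_comp (x : Fin r → R) (n : ℕ) :
    koszulDifferential x n ∘ₗ koszulDifferential x (n + 1) = 0 := by
  apply exteriorPower.linearMap_ext
  have h := AlternatingMap.alternatizeUncurryFin_alternatizeUncurryFinLM_comp_of_symmetric
    (f := (koszulForm x).smulRight
      ((koszulForm x).smulRight (exteriorPower.ιMulti R n (M := Fin r → R))))
    (fun a b => by ext w; simp [smul_smul, mul_comm])
  ext1 w
  have hw := congrArg (fun g => g w) h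
  simp [koszulDifferential, AlternatingMap.alternatizeUncurryFin_apply] at hw ⊢
  simpa using hw

variable (M : Type v) [AddCommGroup M] [Module R M]

/-- The cocycles of degree `n` of `Hom_R(K_•(x), M)`. -/
def koszulCocycles (x : Fin r → R) (n : ℕ) : Submodule R (⋀[R]^n (Fin r → R) →ₗ[R] M) :=
  LinearMap.ker (LinearMap.lcomp R M (koszulDifferential x n))

/-- The coboundaries of degree `n` of `Hom_R(K_•(x), M)`. -/
def koszulCoboundaries (x : Fin r → R) :
    (n : ℕ) → Submodule R (⋀[R]^n (Fin r → R) →ₗ[R] M)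
  | 0 => ⊥
  | n + 1 => LinearMap.range (LinearMap.lcomp R M (koszulDifferential x n))

/-- The Koszul cohomology module `H^n(Hom_R(K_•(x), M))`. -/
abbrev KoszulCohomology (x : Fin r → R) (n : ℕ) : Type (max u v) :=
  koszulCocycles M x n ⧸ (koszulCoboundaries M x n).submoduleOf (koszulCocycles M x n)

/-- `inf {n | H^n(Hom_R(K_•(x), M)) ≠ 0}`, with `inf ∅ = ∞`. -/
def koszulGradeSeq (x : Fin r → R) : ℕ∞ :=
  ⨅ (n : ℕ) (_ : Nontrivial (KoszulCohomology M x n)), (n : ℕ∞)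

end Koszul

/-- The Koszul grade `K.grade_R(a, M)` of an arbitrary ideal: the supremum, over all finitely
generated ideals `b ⊆ a`, of the Koszul grade of a finite sequence generating `b`. A finite
sequence of elements of `a` is the same as a generating sequence of some such `b`. -/
def koszulGrade {R : Type u} [CommRing R] (a : Ideal R)
    (M : Type v) [AddCommGroup M] [Module R M] : ℕ∞ :=
  ⨆ (r : ℕ) (x : Fin r → R) (_ : ∀ j, x j ∈ a), koszulGradeSeq M x

/-- The `M`-height `ht_M(a) = inf {dim M_p | p ∈ V(a) ∩ Supp M}`, with `inf ∅ = ∞`. Here `dim M_p`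
is the supremum of the lengths of chains of primes in `Supp M` with largest member `p`. -/
def moduleHeight {R : Type u} [CommRing R] (M : Type v) [AddCommGroup M] [Module R M]
    (a : Ideal R) : ℕ∞ :=
  ⨅ (p : Module.support R M) (_ : a ≤ p.1.asIdeal), Order.height p

section Conditions

variable (R : Type u) [CommRing R] (M : Type v) [AddCommGroup M] [Module R M]

/-- `ht_M(p) = K.grade_R(p, M)` for all primes `p ∈ Supp M`. -/
def IsCMSpec : Prop :=
  ∀ p ∈ Module.support R M, moduleHeight M p.asIdeal = koszulGrade p.asIdeal M

/-- `ht_M(a) = K.grade_R(a, M)` for all ideals `a`. -/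
def IsCMIdeals : Prop :=
  ∀ a : Ideal R, moduleHeight M a = koszulGrade a M

/-- `ht_M(q) = K.grade_{R_p}(qR_p, M_p)` for all primes `q ⊆ p` in `Supp M`. -/
def IsCMLocal : Prop :=
  ∀ p ∈ Module.support R M, ∀ q ∈ Module.support R M, q.asIdeal ≤ p.asIdeal →
    moduleHeight M q.asIdeal =
      koszulGrade (q.asIdeal.map (algebraMap R (Localization.AtPrime p.asIdeal)))
        (LocalizedModule p.asIdeal.primeCompl M)

/-- `ht_M(p) = K.grade_{R_p}(pR_p, M_p)` for all primes `p ∈ Supp M`. -/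
def IsCMGlaz : Prop :=
  ∀ p ∈ Module.support R M,
    moduleHeight M p.asIdeal =
      koszulGrade (p.asIdeal.map (algebraMap R (Localization.AtPrime p.asIdeal)))
        (LocalizedModule p.asIdeal.primeCompl M)

/-- `ht_M(a) = K.grade_R(a, M)` for all finitely generated ideals `a`. -/
def IsCMFGIdeals : Prop :=
  ∀ a : Ideal R, a.FG → moduleHeight M a = koszulGrade a M

end Conditions

end

/-
The argument follows a cocycle `F` representing a nonzero class in the lowest nonvanishing Koszul
cohomology, of degree `n`, of a sequence `x` on `M`. Let `I ⊇ (x)` be the annihilator of its class.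
Adjoining an element of `I` to `x` lifts `F` to a class of the same kind, so every finite sequence
in `I`, and then in `√I`, has Koszul grade at most `n`. The class survives localization at a
minimal prime `p` of `I`, where `√I` becomes the maximal ideal: thus `p` contains `(x)` and
`K.grade(pR_p, M_p) ≤ n`, which gives (iv) ⇒ (v).

The inequality `K.grade ≤ ht` always holds. Localization does not lower the Koszul grade, and over
a local ring with `dim Supp M = d`, Kronecker's theorem in the form of Coquand and Lombardi replaces
any finite sequence in the maximal ideal by one of length `d` whose ideal has at least as large a
radical modulo `Ann M`; the top-degree Koszul cohomology of the latter is nonzero by Nakayama.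

For (i) ⇒ (ii), `K.grade(ab) ≥ min (K.grade a) (K.grade b)` makes the ideals of grade `> g` an Oka
family, so an ideal maximal among those of grade `≤ g` is prime.
-/

noncomputable section

section KoszulForms

open AlternatingMap

variable {R : Type u} [CommRing R] {V W N N' : Type*} [AddCommGroup V] [Module R V]
  [AddCommGroup W] [Module R W] [AddCommGroup N] [Module R N] [AddCommGroup N'] [Module R N']
  {n : ℕ}

/-- The Koszul differential `F ↦ φ ∧ F` on `N`-valued alternating forms on `V`. For `φ` the linear
form of a sequence `x`, the resulting complex is `Hom_R(K_•(x), N)`. -/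
def koszulDiff (φ : V →ₗ[R] R) (n : ℕ) :
    (V [⋀^Fin n]→ₗ[R] N) →ₗ[R] (V [⋀^Fin (n + 1)]→ₗ[R] N) :=
  alternatizeUncurryFinLM ∘ₗ LinearMap.smulRightₗ φ

theorem koszulDiff_apply (φ : V →ₗ[R] R) (F : V [⋀^Fin n]→ₗ[R] N) (w : Fin (n + 1) → V) :
    koszulDiff φ n F w =
      ∑ j : Fin (n + 1), (-1 : ℤ) ^ (j : ℕ) • (φ (w j) • F (j.removeNth w)) := by
  simp [koszulDiff, alternatizeUncurryFin_apply]

theorem koszulDiff_compLinearMap (φ : V →ₗ[R] R) (f : W →ₗ[R] V) (F : V [⋀^Fin n]→ₗ[R] N) :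
    koszulDiff (φ ∘ₗ f) n (F.compLinearMap f) = (koszulDiff φ n F).compLinearMap f := by
  ext w
  simp only [koszulDiff_apply, compLinearMap_apply, LinearMap.comp_apply]
  rfl

theorem koszulDiff_compAlternatingMap (f : N →ₗ[R] N') (φ : V →ₗ[R] R)
    (F : V [⋀^Fin n]→ₗ[R] N) :
    koszulDiff φ n (f.compAlternatingMap F) = f.compAlternatingMap (koszulDiff φ n F) := by
  ext w
  simp [koszulDiff_apply]

theorem koszulDiff_zero_form (F : V [⋀^Fin n]→ₗ[R] N) : koszulDiff (0 : V →ₗ[R] R) n F = 0 := by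
  ext w
  simp [koszulDiff_apply]

theorem curryLeft_koszulDiff_zero (φ : V →ₗ[R] R) (F : V [⋀^Fin 0]→ₗ[R] N) (v : V) :
    (koszulDiff φ 0 F).curryLeft v = φ v • F := by
  ext w
  simp [koszulDiff_apply, Subsingleton.elim _ w]

theorem curryLeft_koszulDiff_succ (φ : V →ₗ[R] R) (F : V [⋀^Fin (n + 1)]→ₗ[R] N) (v : V) :
    (koszulDiff φ (n + 1) F).curryLeft v = φ v • F - koszulDiff φ n (F.curryLeft v) := by
  ext w
  have removeNth_succ (j : Fin (n + 1)) :
      j.succ.removeNth (Matrix.vecCons v w) = Matrix.vecCons v (j.removeNth w) := by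
    funext i
    cases i using Fin.cases <;> simp [Fin.removeNth, Matrix.vecCons]
  rw [curryLeft_apply_apply, koszulDiff_apply, Fin.sum_univ_succ, AlternatingMap.sub_apply,
    AlternatingMap.smul_apply, koszulDiff_apply, sub_eq_add_neg, ← Finset.sum_neg_distrib]
  congr 1
  · simp [Matrix.vecCons]
  · refine Finset.sum_congr rfl fun j _ => ?_
    rw [removeNth_succ]
    simp [pow_succ]

variable (N) in
/-- The coboundaries of degree `n` of the complex with differentials `koszulDiff φ`. -/
def koszulBoundaries (φ : V →ₗ[R] R) : (n : ℕ) → Submodule R (V [⋀^Fin n]→ₗ[R] N)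
  | 0 => ⊥
  | n + 1 => LinearMap.range (koszulDiff φ n)

theorem mem_koszulBoundaries_zero {φ : V →ₗ[R] R} {F : V [⋀^Fin 0]→ₗ[R] N} :
    F ∈ koszulBoundaries N φ 0 ↔ F = 0 :=
  Submodule.mem_bot R

theorem compLinearMap_mem_koszulBoundaries {φ : V →ₗ[R] R} (f : W →ₗ[R] V)
    {F : V [⋀^Fin n]→ₗ[R] N} (hF : F ∈ koszulBoundaries N φ n) :
    F.compLinearMap f ∈ koszulBoundaries N (φ ∘ₗ f) n := by
  cases n with
  | zero =>
    rw [mem_koszulBoundaries_zero] at hF ⊢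
    rw [hF, zero_compLinearMap]
  | succ n =>
    obtain ⟨G, rfl⟩ := hF
    exact ⟨G.compLinearMap f, koszulDiff_compLinearMap φ f G⟩

theorem apply_mem_smul_top_of_mem_koszulBoundaries {φ : V →ₗ[R] R} {F : V [⋀^Fin n]→ₗ[R] N}
    (hF : F ∈ koszulBoundaries N φ n) (w : Fin n → V) :
    F w ∈ LinearMap.range φ • (⊤ : Submodule R N) := by
  cases n with
  | zero =>
    rw [mem_koszulBoundaries_zero.mp hF]
    exact zero_mem _
  | succ n =>
    obtain ⟨G, rfl⟩ := hF
    rw [koszulDiff_apply]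
    exact sum_mem fun j _ => zsmul_mem
      (Submodule.smul_mem_smul (LinearMap.mem_range_self φ _) Submodule.mem_top) _

theorem compLinearMap_equiv_mem_koszulBoundaries {φ : V →ₗ[R] R} (e : W ≃ₗ[R] V)
    {F : V [⋀^Fin n]→ₗ[R] N} :
    F.compLinearMap e.toLinearMap ∈ koszulBoundaries N (φ ∘ₗ e.toLinearMap) n ↔
      F ∈ koszulBoundaries N φ n := by
  refine ⟨fun h => ?_, compLinearMap_mem_koszulBoundaries _⟩
  simpa only [LinearMap.comp_assoc, LinearEquiv.comp_symm, LinearMap.comp_id,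
    compLinearMap_assoc, compLinearMap_id]
    using compLinearMap_mem_koszulBoundaries e.symm.toLinearMap h

-- Contraction with `v` is a homotopy between multiplication by `φ v` and zero.
theorem smul_mem_koszulBoundaries (φ : V →ₗ[R] R) (v : V) {F : V [⋀^Fin n]→ₗ[R] N}
    (hF : koszulDiff φ n F = 0) : φ v • F ∈ koszulBoundaries N φ n := by
  cases n with
  | zero => rw [mem_koszulBoundaries_zero, ← curryLeft_koszulDiff_zero, hF, curryLeft_zero,
      LinearMap.zero_apply]
  | succ n =>
    refine ⟨F.curryLeft v, (sub_eq_zero.mp ?_).symm⟩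
    rw [← curryLeft_koszulDiff_succ, hF, curryLeft_zero, LinearMap.zero_apply]

/-- The ideal of scalars killing the class of `F` in Koszul cohomology. -/
def koszulAnnihilator (φ : V →ₗ[R] R) (F : V [⋀^Fin n]→ₗ[R] N) : Ideal R :=
  (koszulBoundaries N φ n).colon {F}

theorem mem_koszulAnnihilator {φ : V →ₗ[R] R} {F : V [⋀^Fin n]→ₗ[R] N} {t : R} :
    t ∈ koszulAnnihilator φ F ↔ t • F ∈ koszulBoundaries N φ n :=
  Submodule.mem_colon_singleton

theorem koszulAnnihilator_eq_top {φ : V →ₗ[R] R} {F : V [⋀^Fin n]→ₗ[R] N} :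
    koszulAnnihilator φ F = ⊤ ↔ F ∈ koszulBoundaries N φ n := by
  rw [Ideal.eq_top_iff_one, mem_koszulAnnihilator, one_smul]

theorem range_le_koszulAnnihilator {φ : V →ₗ[R] R} {F : V [⋀^Fin n]→ₗ[R] N}
    (hF : koszulDiff φ n F = 0) : LinearMap.range φ ≤ koszulAnnihilator φ F := by
  rintro _ ⟨v, rfl⟩
  exact mem_koszulAnnihilator.mpr (smul_mem_koszulBoundaries φ v hF)

theorem annihilator_le_koszulAnnihilator (φ : V →ₗ[R] R) (F : V [⋀^Fin n]→ₗ[R] N) :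
    Module.annihilator R N ≤ koszulAnnihilator φ F := by
  intro t ht
  have smul_eq_zero : t • F = 0 := by
    ext w
    exact Module.mem_annihilator.mp ht (F w)
  rw [mem_koszulAnnihilator, smul_eq_zero]
  exact zero_mem _

variable (N) in
/-- Vanishing of the degree `n` Koszul cohomology of `φ` with values in `N`. -/
def KoszulExactAt (φ : V →ₗ[R] R) (n : ℕ) : Prop :=
  ∀ F : V [⋀^Fin n]→ₗ[R] N, koszulDiff φ n F = 0 → F ∈ koszulBoundaries N φ n

theorem KoszulExactAt.comp_equiv {φ : V →ₗ[R] R} (h : KoszulExactAt N φ n) (e : W ≃ₗ[R] V) :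
    KoszulExactAt N (φ ∘ₗ e.toLinearMap) n := by
  intro F hF
  obtain ⟨F, rfl⟩ := (domLCongr R N (Fin n) R e.symm).surjective F
  have hF' : koszulDiff φ n F = 0 := (domLCongr R N (Fin (n + 1)) R e.symm).injective <| by
    simpa using (koszulDiff_compLinearMap φ e.toLinearMap F).symm.trans hF
  exact compLinearMap_mem_koszulBoundaries _ (h F hF')

section Snoc

/-- The form `(v, c) ↦ φ v + c z` on `V × R`, whose Koszul complex is that of `φ` with the element
`z` adjoined. -/
abbrev formSnoc (φ : V →ₗ[R] R) (z : R) : V × R →ₗ[R] R :=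
  φ.coprod (LinearMap.toSpanSingleton R R z)

theorem formSnoc_zero_one (φ : V →ₗ[R] R) (z : R) : formSnoc φ z (0, 1) = z := by
  simp

/-- Restriction of forms along `V → V × R`. -/
def formRes : ((V × R) [⋀^Fin n]→ₗ[R] N) →ₗ[R] (V [⋀^Fin n]→ₗ[R] N) where
  toFun F := F.compLinearMap (LinearMap.inl R V R)
  map_add' _ _ := rfl
  map_smul' _ _ := rfl

/-- Contraction of a form with the vector `(0, 1)` of `V × R`, restricted to `V`. -/
def formContr : ((V × R) [⋀^Fin (n + 1)]→ₗ[R] N) →ₗ[R] (V [⋀^Fin n]→ₗ[R] N) :=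
  formRes ∘ₗ curryLeftLinearMap.flip ((0 : V), (1 : R))

theorem formRes_compLinearMap_fst (f : V [⋀^Fin n]→ₗ[R] N) :
    formRes (f.compLinearMap (LinearMap.fst R V R)) = f :=
  rfl

theorem formContr_compLinearMap_fst (f : V [⋀^Fin (n + 1)]→ₗ[R] N) :
    formContr (f.compLinearMap (LinearMap.fst R V R)) = 0 := by
  ext w
  exact f.map_coord_zero 0 rfl

theorem formRes_koszulDiff (φ : V →ₗ[R] R) (z : R) (F : (V × R) [⋀^Fin n]→ₗ[R] N) :
    formRes (koszulDiff (formSnoc φ z) n F) = koszulDiff φ n (formRes F) := by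
  have h := koszulDiff_compLinearMap (formSnoc φ z) (LinearMap.inl R V R) F
  rw [LinearMap.coprod_inl] at h
  exact h.symm

theorem formContr_koszulDiff_zero (φ : V →ₗ[R] R) (z : R) (F : (V × R) [⋀^Fin 0]→ₗ[R] N) :
    formContr (koszulDiff (formSnoc φ z) 0 F) = z • formRes F := by
  have h := curryLeft_koszulDiff_zero (formSnoc φ z) F (0, 1)
  rw [formSnoc_zero_one] at h
  exact congrArg formRes h

theorem formContr_koszulDiff_succ (φ : V →ₗ[R] R) (z : R)
    (F : (V × R) [⋀^Fin (n + 1)]→ₗ[R] N) :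
    formContr (koszulDiff (formSnoc φ z) (n + 1) F) =
      z • formRes F - koszulDiff φ n (formContr F) := by
  have h := curryLeft_koszulDiff_succ (formSnoc φ z) F (0, 1)
  rw [formSnoc_zero_one] at h
  have h' := congrArg formRes h
  rwa [map_sub, map_smul, formRes_koszulDiff] at h'

theorem exists_formRes_formContr (f : V [⋀^Fin (n + 1)]→ₗ[R] N) (g : V [⋀^Fin n]→ₗ[R] N) :
    ∃ F : (V × R) [⋀^Fin (n + 1)]→ₗ[R] N, formRes F = f ∧ formContr F = g := by
  -- Wedging with the second projection `V × R → R` is a section of contraction.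
  let wedge := koszulDiff (formSnoc (0 : V →ₗ[R] R) 1) n (g.compLinearMap (LinearMap.fst R V R))
  have res_wedge : formRes wedge = 0 := by rw [formRes_koszulDiff, koszulDiff_zero_form]
  have contr_wedge : formContr wedge = g := by
    cases n with
    | zero => rw [formContr_koszulDiff_zero, one_smul, formRes_compLinearMap_fst]
    | succ n => rw [formContr_koszulDiff_succ, koszulDiff_zero_form, sub_zero, one_smul,
        formRes_compLinearMap_fst]
  refine ⟨f.compLinearMap (LinearMap.fst R V R) + wedge, ?_, ?_⟩
  · rw [map_add, res_wedge, formRes_compLinearMap_fst, add_zero]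
  · rw [map_add, contr_wedge, formContr_compLinearMap_fst, zero_add]

theorem formRes_injective_zero :
    Function.Injective (formRes : ((V × R) [⋀^Fin 0]→ₗ[R] N) →ₗ[R] (V [⋀^Fin 0]→ₗ[R] N)) := by
  intro F G h
  ext w
  rw [Subsingleton.elim w fun i => LinearMap.inl R V R (i.elim0)]
  exact congr($h fun i => i.elim0)

theorem eq_zero_of_formRes_eq_zero {F : (V × R) [⋀^Fin n]→ₗ[R] N} (hres : formRes F = 0)
    (hF : ∀ (w : Fin n → V × R) (i : Fin n), w i = ((0 : V), (1 : R)) → F w = 0) : F = 0 := by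
  classical
  ext w
  have split : w = (fun i => LinearMap.inl R V R (w i).1) +
      (fun i => (w i).2 • ((0 : V), (1 : R))) := by
    funext i
    simp
  rw [split, AlternatingMap.zero_apply, F.map_add_univ]
  refine Finset.sum_eq_zero fun s _ => ?_
  rcases eq_or_ne s Finset.univ with rfl | hs
  · rw [Finset.piecewise_univ]
    exact congr($hres fun i => (w i).1)
  · obtain ⟨i, hi⟩ : ∃ i, i ∉ s := by
      simpa [Finset.eq_univ_iff_forall] using hs
    generalize hm : s.piecewise (fun i => LinearMap.inl R V R (w i).1)
      (fun i => (w i).2 • ((0 : V), (1 : R))) = m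
    have hmi : m i = (w i).2 • ((0 : V), (1 : R)) := by
      rw [← hm, Finset.piecewise_eq_of_notMem _ _ _ hi]
    rw [← Function.update_eq_self i m, hmi, F.map_update_smul,
      hF _ i (Function.update_self i _ m), smul_zero]

theorem eq_zero_of_formRes_formContr {F : (V × R) [⋀^Fin (n + 1)]→ₗ[R] N}
    (hres : formRes F = 0) (hcontr : formContr F = 0) : F = 0 := by
  have curry_eq_zero : F.curryLeft ((0 : V), (1 : R)) = 0 :=
    eq_zero_of_formRes_eq_zero hcontr fun w i hi =>
      F.map_eq_zero_of_eq _ (i := 0) (j := i.succ) (by simp [hi]) (Fin.succ_ne_zero i).symm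
  refine eq_zero_of_formRes_eq_zero hres fun w i hi => ?_
  have move_to_front := F.map_insertNth i (w i) (i.removeNth w)
  rw [Fin.insertNth_self_removeNth, hi, ← curryLeft_apply_apply, curry_eq_zero,
    AlternatingMap.zero_apply, smul_zero] at move_to_front
  exact move_to_front

theorem eq_of_formRes_formContr {F G : (V × R) [⋀^Fin (n + 1)]→ₗ[R] N}
    (hres : formRes F = formRes G) (hcontr : formContr F = formContr G) : F = G :=
  sub_eq_zero.mp <| eq_zero_of_formRes_formContr (by rw [map_sub, hres, sub_self])
    (by rw [map_sub, hcontr, sub_self])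

theorem formRes_mem_koszulBoundaries {φ : V →ₗ[R] R} {z : R} {F : (V × R) [⋀^Fin n]→ₗ[R] N}
    (hF : F ∈ koszulBoundaries N (formSnoc φ z) n) : formRes F ∈ koszulBoundaries N φ n := by
  have h := compLinearMap_mem_koszulBoundaries (LinearMap.inl R V R) hF
  rwa [LinearMap.coprod_inl] at h

theorem mem_koszulBoundaries_of_formRes {φ : V →ₗ[R] R} {z : R}
    {F : (V × R) [⋀^Fin n]→ₗ[R] N} (hF : koszulDiff (formSnoc φ z) n F = 0)
    (hres : formRes F ∈ koszulBoundaries N φ n)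
    (hex : ∀ m, m + 1 = n → KoszulExactAt N φ m) : F ∈ koszulBoundaries N (formSnoc φ z) n := by
  cases n with
  | zero =>
    rw [mem_koszulBoundaries_zero] at hres ⊢
    exact formRes_injective_zero hres
  | succ n =>
    obtain ⟨f, hf⟩ := hres
    have cocycle : koszulDiff φ n (z • f - formContr F) = 0 := by
      rw [map_sub, map_smul, hf, ← formContr_koszulDiff_succ, hF, _root_.map_zero]
    have coboundary := hex n rfl _ cocycle
    cases n with
    | zero =>
      rw [mem_koszulBoundaries_zero, sub_eq_zero] at coboundary
      refine ⟨f.compLinearMap (LinearMap.fst R V R), eq_of_formRes_formContr ?_ ?_⟩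
      · rw [formRes_koszulDiff, formRes_compLinearMap_fst, hf]
      · rw [formContr_koszulDiff_zero, formRes_compLinearMap_fst, coboundary]
    | succ n =>
      obtain ⟨g, hg⟩ := coboundary
      obtain ⟨G, hGres, hGcontr⟩ := exists_formRes_formContr f g
      refine ⟨G, eq_of_formRes_formContr ?_ ?_⟩
      · rw [formRes_koszulDiff, hGres, hf]
      · rw [formContr_koszulDiff_succ, hGres, hGcontr, hg, sub_sub_cancel]

theorem KoszulExactAt.snoc {φ : V →ₗ[R] R} (h : KoszulExactAt N φ n)
    (hex : ∀ m, m + 1 = n → KoszulExactAt N φ m) (z : R) : KoszulExactAt N (formSnoc φ z) n :=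
  fun F hF => mem_koszulBoundaries_of_formRes hF
    (h _ (by rw [← formRes_koszulDiff, hF, _root_.map_zero])) hex

theorem exists_cocycle_formRes {φ : V →ₗ[R] R} {z : R} {f : V [⋀^Fin n]→ₗ[R] N}
    (hf : koszulDiff φ n f = 0) (hz : z ∈ koszulAnnihilator φ f) :
    ∃ F : (V × R) [⋀^Fin n]→ₗ[R] N, koszulDiff (formSnoc φ z) n F = 0 ∧ formRes F = f := by
  rw [mem_koszulAnnihilator] at hz
  cases n with
  | zero =>
    rw [mem_koszulBoundaries_zero] at hz
    refine ⟨f.compLinearMap (LinearMap.fst R V R), eq_zero_of_formRes_formContr ?_ ?_, rfl⟩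
    · rw [formRes_koszulDiff, formRes_compLinearMap_fst, hf]
    · rw [formContr_koszulDiff_zero, formRes_compLinearMap_fst, hz]
  | succ n =>
    obtain ⟨g, hg⟩ := hz
    obtain ⟨F, hres, hcontr⟩ := exists_formRes_formContr f g
    refine ⟨F, eq_zero_of_formRes_formContr ?_ ?_, hres⟩
    · rw [formRes_koszulDiff, hres, hf]
    · rw [formContr_koszulDiff_succ, hres, hcontr, hg, sub_self]

end Snoc

/-- A cocycle representing a nonzero class in the lowest nonvanishing Koszul cohomology of `φ`. -/
structure IsLeadingKoszulClass (φ : V →ₗ[R] R) (F : V [⋀^Fin n]→ₗ[R] N) : Prop where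
  exactAt_of_lt : ∀ i < n, KoszulExactAt N φ i
  cocycle : koszulDiff φ n F = 0
  notMem_boundaries : F ∉ koszulBoundaries N φ n

namespace IsLeadingKoszulClass

variable {φ : V →ₗ[R] R} {F : V [⋀^Fin n]→ₗ[R] N}

theorem not_koszulExactAt (hF : IsLeadingKoszulClass φ F) : ¬ KoszulExactAt N φ n :=
  fun h => hF.notMem_boundaries (h F hF.cocycle)

theorem koszulAnnihilator_ne_top (hF : IsLeadingKoszulClass φ F) :
    koszulAnnihilator φ F ≠ ⊤ :=
  koszulAnnihilator_eq_top.not.mpr hF.notMem_boundaries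

theorem nontrivial (hF : IsLeadingKoszulClass φ F) : Nontrivial N := by
  by_contra h
  rw [not_nontrivial_iff_subsingleton] at h
  have : F = 0 := AlternatingMap.ext fun _ => Subsingleton.elim _ _
  exact hF.notMem_boundaries (this ▸ zero_mem _)

theorem smul (hF : IsLeadingKoszulClass φ F) {t : R} (ht : t ∉ koszulAnnihilator φ F) :
    IsLeadingKoszulClass φ (t • F) where
  exactAt_of_lt := hF.exactAt_of_lt
  cocycle := by rw [map_smul, hF.cocycle, smul_zero]
  notMem_boundaries := mem_koszulAnnihilator.not.mp ht

theorem comp_equiv (hF : IsLeadingKoszulClass φ F) (e : W ≃ₗ[R] V) :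
    IsLeadingKoszulClass (φ ∘ₗ e.toLinearMap) (F.compLinearMap e.toLinearMap) where
  exactAt_of_lt i hi := (hF.exactAt_of_lt i hi).comp_equiv e
  cocycle := by rw [koszulDiff_compLinearMap, hF.cocycle, zero_compLinearMap]
  notMem_boundaries :=
    (compLinearMap_equiv_mem_koszulBoundaries e).not.mpr hF.notMem_boundaries

theorem exists_snoc (hF : IsLeadingKoszulClass φ F) {z : R} (hz : z ∈ koszulAnnihilator φ F) :
    ∃ G : (V × R) [⋀^Fin n]→ₗ[R] N, IsLeadingKoszulClass (formSnoc φ z) G ∧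
      koszulAnnihilator φ F ≤ koszulAnnihilator (formSnoc φ z) G := by
  obtain ⟨G, cocycle, rfl⟩ := exists_cocycle_formRes hF.cocycle hz
  have hex (m : ℕ) (hm : m + 1 = n) : KoszulExactAt N φ m := hF.exactAt_of_lt m (by omega)
  refine ⟨G, ⟨fun i hi => ?_, cocycle, ?_⟩, fun t ht => ?_⟩
  · exact (hF.exactAt_of_lt i hi).snoc (fun m hm => hF.exactAt_of_lt m (by omega)) z
  · exact fun hG => hF.notMem_boundaries (formRes_mem_koszulBoundaries hG)
  · rw [mem_koszulAnnihilator] at ht ⊢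
    rw [← map_smul] at ht
    exact mem_koszulBoundaries_of_formRes (by rw [map_smul, cocycle, smul_zero]) ht hex

end IsLeadingKoszulClass

section Append

variable {m : ℕ}

/-- `V × R^(m+1) ≃ (V × R^m) × R`, moving the first coordinate of `R^(m+1)` to the end. -/
def prodFinSuccEquiv (R V : Type*) [CommRing R] [AddCommGroup V] [Module R V] (m : ℕ) :
    (V × (Fin (m + 1) → R)) ≃ₗ[R] (V × (Fin m → R)) × R :=
  (LinearEquiv.refl R V).prodCongr
      ((Fin.consLinearEquiv R fun _ => R).symm ≪≫ₗ LinearEquiv.prodComm R R (Fin m → R)) ≪≫ₗ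
    (LinearEquiv.prodAssoc R V (Fin m → R) R).symm

theorem formSnoc_comp_prodFinSuccEquiv (φ : V →ₗ[R] R) (y : Fin (m + 1) → R) :
    formSnoc (φ.coprod (koszulForm (Fin.tail y))) (y 0) ∘ₗ
      (prodFinSuccEquiv R V m).toLinearMap = φ.coprod (koszulForm y) := by
  refine LinearMap.ext fun p => ?_
  change φ p.1 + koszulForm (Fin.tail y) (Fin.tail p.2) + p.2 0 * y 0 = φ p.1 + koszulForm y p.2
  simp only [koszulForm, Fintype.linearCombination_apply, Fin.sum_univ_succ, Fin.tail, smul_eq_mul]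
  abel

theorem comp_prodUnique (φ : V →ₗ[R] R) (y : Fin 0 → R) :
    φ ∘ₗ (LinearEquiv.prodUnique (R := R) (M := V) (M₂ := Fin 0 → R)).toLinearMap =
      φ.coprod (koszulForm y) := by
  refine LinearMap.ext fun p => ?_
  simp [koszulForm, Fintype.linearCombination_apply]

theorem KoszulExactAt.append {φ : V →ₗ[R] R} {g : ℕ} (h : ∀ i < g, KoszulExactAt N φ i)
    (y : Fin m → R) : ∀ i < g, KoszulExactAt N (φ.coprod (koszulForm y)) i := by
  induction m with
  | zero =>
    intro i hi
    rw [← comp_prodUnique]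
    exact (h i hi).comp_equiv _
  | succ m ih =>
    intro i hi
    rw [← formSnoc_comp_prodFinSuccEquiv]
    exact ((ih _ i hi).snoc (fun k hk => ih _ k (by omega)) _).comp_equiv _

theorem koszulAnnihilator_comp_equiv (φ : V →ₗ[R] R) (F : V [⋀^Fin n]→ₗ[R] N) (e : W ≃ₗ[R] V) :
    koszulAnnihilator (φ ∘ₗ e.toLinearMap) (F.compLinearMap e.toLinearMap) =
      koszulAnnihilator φ F := by
  ext t
  rw [mem_koszulAnnihilator, mem_koszulAnnihilator, ← compLinearMap_equiv_mem_koszulBoundaries e]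
  rfl

theorem IsLeadingKoszulClass.exists_append {φ : V →ₗ[R] R} {F : V [⋀^Fin n]→ₗ[R] N}
    (hF : IsLeadingKoszulClass φ F) (y : Fin m → R) (hy : ∀ j, y j ∈ koszulAnnihilator φ F) :
    ∃ G : (V × (Fin m → R)) [⋀^Fin n]→ₗ[R] N,
      IsLeadingKoszulClass (φ.coprod (koszulForm y)) G ∧
        koszulAnnihilator φ F ≤ koszulAnnihilator (φ.coprod (koszulForm y)) G := by
  induction m with
  | zero =>
    rw [← comp_prodUnique]
    exact ⟨_, hF.comp_equiv _, (koszulAnnihilator_comp_equiv φ F _).ge⟩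
  | succ m ih =>
    obtain ⟨G, hG, le_G⟩ := ih (Fin.tail y) fun j => hy j.succ
    obtain ⟨H, hH, le_H⟩ := hG.exists_snoc (le_G (hy 0))
    rw [← formSnoc_comp_prodFinSuccEquiv]
    exact ⟨_, hH.comp_equiv _,
      (le_G.trans le_H).trans (koszulAnnihilator_comp_equiv _ H _).ge⟩

end Append

end KoszulForms

section Grade

open AlternatingMap exteriorPower

variable {R : Type u} [CommRing R] {M : Type v} [AddCommGroup M] [Module R M] {r m n : ℕ}

theorem range_koszulForm (x : Fin r → R) :
    LinearMap.range (koszulForm x) = Ideal.span (Set.range x) :=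
  Fintype.range_linearCombination R x

theorem alternatingMapLinearEquiv_koszulDiff (x : Fin r → R)
    (F : (Fin r → R) [⋀^Fin n]→ₗ[R] M) :
    alternatingMapLinearEquiv (koszulDiff (koszulForm x) n F) =
      LinearMap.lcomp R M (koszulDifferential x n) (alternatingMapLinearEquiv F) := by
  apply exteriorPower.linearMap_ext
  ext1 w
  simp [koszulDifferential_ιMulti, koszulDiff_apply]

theorem alternatingMapLinearEquiv_mem_koszulCocycles {x : Fin r → R}
    {F : (Fin r → R) [⋀^Fin n]→ₗ[R] M} :
    alternatingMapLinearEquiv F ∈ koszulCocycles M x n ↔ koszulDiff (koszulForm x) n F = 0 := by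
  rw [koszulCocycles, LinearMap.mem_ker, ← alternatingMapLinearEquiv_koszulDiff,
    LinearEquiv.map_eq_zero_iff]

theorem alternatingMapLinearEquiv_mem_koszulCoboundaries {x : Fin r → R}
    {F : (Fin r → R) [⋀^Fin n]→ₗ[R] M} :
    alternatingMapLinearEquiv F ∈ koszulCoboundaries M x n ↔
      F ∈ koszulBoundaries M (koszulForm x) n := by
  cases n with
  | zero => simp [koszulCoboundaries, koszulBoundaries]
  | succ n =>
    constructor
    · rintro ⟨G, hG⟩
      refine ⟨alternatingMapLinearEquiv.symm G, alternatingMapLinearEquiv.injective ?_⟩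
      rw [alternatingMapLinearEquiv_koszulDiff, LinearEquiv.apply_symm_apply, hG]
    · rintro ⟨G, rfl⟩
      exact ⟨alternatingMapLinearEquiv G, (alternatingMapLinearEquiv_koszulDiff x G).symm⟩

theorem nontrivial_koszulCohomology_iff {x : Fin r → R} :
    Nontrivial (KoszulCohomology M x n) ↔ ¬ KoszulExactAt M (koszulForm x) n := by
  rw [Submodule.Quotient.nontrivial_iff, Ne, not_iff_not, Submodule.submoduleOf,
    Submodule.comap_subtype_eq_top, SetLike.le_def, alternatingMapLinearEquiv.surjective.forall]
  simp only [alternatingMapLinearEquiv_mem_koszulCocycles,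
    alternatingMapLinearEquiv_mem_koszulCoboundaries, KoszulExactAt]

theorem koszulGradeSeq_le {x : Fin r → R} (h : ¬ KoszulExactAt M (koszulForm x) n) :
    koszulGradeSeq M x ≤ n :=
  iInf₂_le n (nontrivial_koszulCohomology_iff.mpr h)

theorem koszulExactAt_of_lt_koszulGradeSeq {x : Fin r → R}
    (h : (n : ℕ∞) < koszulGradeSeq M x) : KoszulExactAt M (koszulForm x) n :=
  not_not.mp fun hc => (koszulGradeSeq_le hc).not_gt h

theorem le_koszulGradeSeq {x : Fin r → R} {g : ℕ∞}
    (h : ∀ i : ℕ, (i : ℕ∞) < g → KoszulExactAt M (koszulForm x) i) :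
    g ≤ koszulGradeSeq M x :=
  le_iInf₂ fun n hn => not_lt.mp fun hlt => nontrivial_koszulCohomology_iff.mp hn (h n hlt)

theorem exists_isLeadingKoszulClass {x : Fin r → R} (h : koszulGradeSeq M x = n) :
    ∃ F : (Fin r → R) [⋀^Fin n]→ₗ[R] M, IsLeadingKoszulClass (koszulForm x) F := by
  have exactAt (i : ℕ) (hi : i < n) : KoszulExactAt M (koszulForm x) i :=
    koszulExactAt_of_lt_koszulGradeSeq (h ▸ Nat.cast_lt.mpr hi)
  have not_exactAt : ¬ KoszulExactAt M (koszulForm x) n := by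
    intro hn
    have : ((n + 1 : ℕ) : ℕ∞) ≤ koszulGradeSeq M x := le_koszulGradeSeq fun i hi =>
      (Nat.lt_succ_iff_lt_or_eq.mp (Nat.cast_lt.mp hi)).elim (exactAt i) (· ▸ hn)
    rw [h, Nat.cast_le] at this
    omega
  simp only [KoszulExactAt, not_forall] at not_exactAt
  obtain ⟨F, hF, hF'⟩ := not_exactAt
  exact ⟨F, exactAt, hF, hF'⟩

theorem span_le_koszulAnnihilator {x : Fin r → R} {F : (Fin r → R) [⋀^Fin n]→ₗ[R] M}
    (hF : koszulDiff (koszulForm x) n F = 0) :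
    Ideal.span (Set.range x) ≤ koszulAnnihilator (koszulForm x) F :=
  range_koszulForm x ▸ range_le_koszulAnnihilator hF

-- Compare both sequences with the concatenation `(x, y)`.
theorem IsLeadingKoszulClass.koszulGradeSeq_le_of_mem {x : Fin r → R}
    {F : (Fin r → R) [⋀^Fin n]→ₗ[R] M} (hF : IsLeadingKoszulClass (koszulForm x) F)
    {y : Fin m → R} (hy : ∀ j, y j ∈ koszulAnnihilator (koszulForm x) F) :
    koszulGradeSeq M y ≤ n := by
  obtain ⟨G, hG, -⟩ := hF.exists_append y hy
  refine le_of_not_gt fun hlt => hG.not_koszulExactAt ?_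
  have exact_y (i : ℕ) (hi : i < n + 1) : KoszulExactAt M (koszulForm y) i :=
    koszulExactAt_of_lt_koszulGradeSeq ((Nat.cast_le.mpr (Nat.le_of_lt_succ hi)).trans_lt hlt)
  have swap : (koszulForm y).coprod (koszulForm x) ∘ₗ (LinearEquiv.prodComm R _ _).toLinearMap =
      (koszulForm x).coprod (koszulForm y) :=
    LinearMap.ext fun p => by simp [add_comm]
  exact swap ▸ (KoszulExactAt.append exact_y x n n.lt_succ_self).comp_equiv _

theorem exists_notMem_forall_mul_mem_of_le_radical {𝔞 J : Ideal R} (h𝔞 : 𝔞.FG) (hJ : J ≠ ⊤)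
    (h : 𝔞 ≤ J.radical) : ∃ t ∉ J, ∀ y ∈ 𝔞, y * t ∈ J := by
  classical
  have hpow : ∃ k, 𝔞 ^ k ≤ J := Ideal.exists_pow_le_of_le_radical_of_fg h h𝔞
  obtain ⟨k, hk⟩ : ∃ k, Nat.find hpow = k + 1 :=
    Nat.exists_eq_succ_of_ne_zero fun h0 =>
      hJ (top_le_iff.mp (by simpa [h0, Ideal.one_eq_top] using Nat.find_spec hpow))
  obtain ⟨t, ht, htJ⟩ := SetLike.not_le_iff_exists.mp (Nat.find_min hpow (m := k) (by omega))
  refine ⟨t, htJ, fun y hy => Nat.find_spec hpow ?_⟩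
  rw [hk, pow_succ']
  exact Ideal.mul_mem_mul hy ht

theorem IsLeadingKoszulClass.koszulGradeSeq_le {x : Fin r → R}
    {F : (Fin r → R) [⋀^Fin n]→ₗ[R] M} (hF : IsLeadingKoszulClass (koszulForm x) F)
    {y : Fin m → R} (hy : ∀ j, y j ∈ (koszulAnnihilator (koszulForm x) F).radical) :
    koszulGradeSeq M y ≤ n := by
  obtain ⟨t, ht, htF⟩ := exists_notMem_forall_mul_mem_of_le_radical
    (Submodule.fg_span (Set.finite_range y)) hF.koszulAnnihilator_ne_top
    (Ideal.span_le.mpr (Set.range_subset_iff.mpr hy))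
  refine (hF.smul ht).koszulGradeSeq_le_of_mem fun j => ?_
  rw [mem_koszulAnnihilator, smul_smul, ← mem_koszulAnnihilator]
  exact htF _ (Ideal.subset_span (Set.mem_range_self j))

theorem koszulGradeSeq_le_of_mem_radical {x : Fin r → R} {y : Fin m → R}
    (hy : ∀ j, y j ∈ (Ideal.span (Set.range x) ⊔ Module.annihilator R M).radical) :
    koszulGradeSeq M y ≤ koszulGradeSeq M x := by
  cases hg : koszulGradeSeq M x with
  | top => exact le_top
  | coe g =>
    obtain ⟨F, hF⟩ := exists_isLeadingKoszulClass hg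
    exact hF.koszulGradeSeq_le fun j => Ideal.radical_mono
      (sup_le (span_le_koszulAnnihilator hF.cocycle) (annihilator_le_koszulAnnihilator _ F)) (hy j)

theorem min_koszulGradeSeq_le {s : ℕ} {y : Fin s → R} {b : Fin r → R} {c : Fin m → R}
    (h : ∀ i j, b i * c j ∈ Ideal.span (Set.range y)) :
    min (koszulGradeSeq M b) (koszulGradeSeq M c) ≤ koszulGradeSeq M y := by
  cases hg : koszulGradeSeq M y with
  | top => exact le_top
  | coe g =>
    obtain ⟨F, hF⟩ := exists_isLeadingKoszulClass hg
    by_cases hb : ∀ i, b i ∈ koszulAnnihilator (koszulForm y) F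
    · exact min_le_of_left_le (hF.koszulGradeSeq_le_of_mem hb)
    · obtain ⟨i, hi⟩ := not_forall.mp hb
      refine min_le_of_right_le ((hF.smul hi).koszulGradeSeq_le_of_mem fun j => ?_)
      rw [mem_koszulAnnihilator, smul_smul, mul_comm, ← mem_koszulAnnihilator]
      exact span_le_koszulAnnihilator hF.cocycle (h i j)

theorem koszulGradeSeq_eq_top {x : Fin r → R} (hx : Ideal.span (Set.range x) = ⊤) :
    koszulGradeSeq M x = ⊤ :=
  top_le_iff.mp <| le_koszulGradeSeq fun _ _ _ hF => koszulAnnihilator_eq_top.mp <|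
    top_le_iff.mp (hx ▸ span_le_koszulAnnihilator hF)

theorem koszulGradeSeq_le_length {x : Fin r → R}
    (hx : Ideal.span (Set.range x) • (⊤ : Submodule R M) ≠ ⊤) : koszulGradeSeq M x ≤ r := by
  obtain ⟨a, -, ha⟩ := SetLike.exists_of_lt (lt_top_iff_ne_top.mpr hx)
  let e := Pi.basisFun R (Fin r)
  let F : (Fin r → R) [⋀^Fin r]→ₗ[R] M :=
    (LinearMap.toSpanSingleton R M a).compAlternatingMap e.det
  have cocycle : koszulDiff (koszulForm x) r F = 0 :=
    Module.Basis.ext_alternating e fun v hv =>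
      absurd (Fintype.card_le_of_injective v hv) (by simp)
  have hFe : F e = a := by simp [F, e.det_self]
  refine koszulGradeSeq_le fun hex => ha ?_
  rw [← range_koszulForm, ← hFe]
  exact apply_mem_smul_top_of_mem_koszulBoundaries (hex F cocycle) e

end Grade

section Localization

open AlternatingMap exteriorPower

variable {R : Type u} [CommRing R] {S : Type*} [CommRing S] [Algebra R S]
  {M : Type v} [AddCommGroup M] [Module R M]
  {N : Type*} [AddCommGroup N] [Module R N] [Module S N] [IsScalarTower R S N] {r n : ℕ}

theorem compLeft_basisFun (j : Fin r) :
    (Algebra.linearMap R S).compLeft (Fin r) (Pi.basisFun R (Fin r) j) =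
      Pi.basisFun S (Fin r) j := by
  ext k
  by_cases h : k = j <;> simp [h]

theorem koszulForm_algebraMap (x w : Fin r → R) :
    koszulForm (algebraMap R S ∘ x) ((Algebra.linearMap R S).compLeft (Fin r) w) =
      algebraMap R S (koszulForm x w) := by
  simp [koszulForm, Fintype.linearCombination_apply]

variable (R) in
/-- Restriction of an `S`-multilinear form on `S^r` to an `R`-multilinear form on `R^r`. -/
def altRestrict :
    ((Fin r → S) [⋀^Fin n]→ₗ[S] N) →ₗ[R] ((Fin r → R) [⋀^Fin n]→ₗ[R] N) where
  toFun F :=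
    { toMultilinearMap := (F.toMultilinearMap.restrictScalars R).compLinearMap
        fun _ => (Algebra.linearMap R S).compLeft (Fin r)
      map_eq_zero_of_eq' := fun w _ _ hw hij => F.map_eq_zero_of_eq _ (by simp [hw]) hij }
  map_add' _ _ := rfl
  map_smul' _ _ := rfl

theorem altRestrict_apply (F : (Fin r → S) [⋀^Fin n]→ₗ[S] N) (w : Fin n → Fin r → R) :
    altRestrict R F w = F fun i => (Algebra.linearMap R S).compLeft (Fin r) (w i) :=
  rfl

theorem altRestrict_koszulDiff (x : Fin r → R) (F : (Fin r → S) [⋀^Fin n]→ₗ[S] N) :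
    altRestrict R (koszulDiff (koszulForm (algebraMap R S ∘ x)) n F) =
      koszulDiff (koszulForm x) n (altRestrict R F) := by
  ext w
  simp only [altRestrict_apply, koszulDiff_apply, koszulForm_algebraMap, algebraMap_smul]
  rfl

theorem altRestrict_injective : Function.Injective
    (altRestrict R : ((Fin r → S) [⋀^Fin n]→ₗ[S] N) →ₗ[R] _) := by
  intro F G h
  refine Module.Basis.ext_alternating (Pi.basisFun S (Fin r)) fun v _ => ?_
  have apply_basis := congr($h fun i => Pi.basisFun R (Fin r) (v i))
  simpa only [altRestrict_apply, compLeft_basisFun] using apply_basis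

theorem altRestrict_surjective : Function.Surjective
    (altRestrict R : ((Fin r → S) [⋀^Fin n]→ₗ[S] N) →ₗ[R] _) := by
  intro G
  let bS := (Pi.basisFun S (Fin r)).exteriorPower n
  let bR := (Pi.basisFun R (Fin r)).exteriorPower n
  let L : ⋀[S]^n (Fin r → S) →ₗ[S] N := bS.constr S fun s => alternatingMapLinearEquiv G (bR s)
  refine ⟨alternatingMapLinearEquiv.symm L, alternatingMapLinearEquiv.injective ?_⟩
  refine bR.ext fun s => ?_
  have hL : L (bS s) = alternatingMapLinearEquiv G (bR s) := bS.constr_basis S _ s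
  rw [← hL]
  simp only [bR, bS, exteriorPower.basis_apply, exteriorPower.ιMulti_family,
    alternatingMapLinearEquiv_apply_ιMulti, altRestrict_apply,
    alternatingMapLinearEquiv_symm_apply, Function.comp_apply, compLeft_basisFun]
  rfl

theorem exists_compAlternatingMap_eq_smul (T : Submonoid R) (f : M →ₗ[R] N)
    [IsLocalizedModule T f] (G : (Fin r → R) [⋀^Fin n]→ₗ[R] N) :
    ∃ (F : (Fin r → R) [⋀^Fin n]→ₗ[R] M) (s : T), f.compAlternatingMap F = s • G := by
  have := Module.finitePresentation_of_projective R (⋀[R]^n (Fin r → R))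
  obtain ⟨h, s, hs⟩ := Module.FinitePresentation.exists_lift_of_isLocalizedModule T f
    (alternatingMapLinearEquiv G)
  refine ⟨alternatingMapLinearEquiv.symm h, s, ?_⟩
  ext w
  simpa using congr($hs (ιMulti R n w))

theorem exists_smul_eq_of_compAlternatingMap_eq (T : Submonoid R) (f : M →ₗ[R] N)
    [IsLocalizedModule T f] {F G : (Fin r → R) [⋀^Fin n]→ₗ[R] M}
    (h : f.compAlternatingMap F = f.compAlternatingMap G) : ∃ s : T, s • F = s • G := by
  obtain ⟨s, hs⟩ := Module.Finite.exists_smul_of_comp_eq_of_isLocalizedModule T f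
    (alternatingMapLinearEquiv F) (alternatingMapLinearEquiv G) <| by
      apply exteriorPower.linearMap_ext
      ext1 w
      simpa using congr($h w)
  refine ⟨s, ?_⟩
  ext w
  simpa using congr($hs (ιMulti R n w))

variable (R S N r n) in
/-- `altRestrict` as an equivalence: on either side a form is freely determined by its values on
increasing tuples of standard basis vectors. -/
def altRestrictEquiv :
    ((Fin r → S) [⋀^Fin n]→ₗ[S] N) ≃ₗ[R] ((Fin r → R) [⋀^Fin n]→ₗ[R] N) :=
  LinearEquiv.ofBijective (altRestrict R) ⟨altRestrict_injective, altRestrict_surjective⟩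

variable (S) in
/-- For an `R`-linear map `f : M → N` to an `S`-module, this sends an `M`-valued form on `R^r` to
the induced `N`-valued form on `S^r`. -/
def altLocalize (f : M →ₗ[R] N) :
    ((Fin r → R) [⋀^Fin n]→ₗ[R] M) →ₗ[R] ((Fin r → S) [⋀^Fin n]→ₗ[S] N) :=
  (altRestrictEquiv R S N r n).symm.toLinearMap ∘ₗ f.compAlternatingMapₗ R

theorem altRestrict_altLocalize (f : M →ₗ[R] N) (F : (Fin r → R) [⋀^Fin n]→ₗ[R] M) :
    altRestrict R (altLocalize S f F) = f.compAlternatingMap F :=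
  (altRestrictEquiv R S N r n).apply_symm_apply _

theorem koszulDiff_altLocalize (f : M →ₗ[R] N) (x : Fin r → R)
    (F : (Fin r → R) [⋀^Fin n]→ₗ[R] M) :
    koszulDiff (koszulForm (algebraMap R S ∘ x)) n (altLocalize S f F) =
      altLocalize S f (koszulDiff (koszulForm x) n F) :=
  altRestrict_injective <| by
    rw [altRestrict_koszulDiff, altRestrict_altLocalize, altRestrict_altLocalize,
      koszulDiff_compAlternatingMap]

theorem altLocalize_mem_koszulBoundaries (f : M →ₗ[R] N) {x : Fin r → R}
    {F : (Fin r → R) [⋀^Fin n]→ₗ[R] M} (hF : F ∈ koszulBoundaries M (koszulForm x) n) :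
    altLocalize S f F ∈ koszulBoundaries N (koszulForm (algebraMap R S ∘ x)) n := by
  cases n with
  | zero =>
    rw [mem_koszulBoundaries_zero] at hF ⊢
    rw [hF, _root_.map_zero]
  | succ n =>
    obtain ⟨G, rfl⟩ := hF
    exact ⟨altLocalize S f G, koszulDiff_altLocalize f x G⟩

instance : IsScalarTower R S ((Fin r → S) [⋀^Fin n]→ₗ[S] N) where
  smul_assoc a b F := by
    ext w
    exact smul_assoc a b (F w)

theorem map_koszulAnnihilator_le (f : M →ₗ[R] N) (x : Fin r → R)
    (F : (Fin r → R) [⋀^Fin n]→ₗ[R] M) :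
    (koszulAnnihilator (koszulForm x) F).map (algebraMap R S) ≤
      koszulAnnihilator (koszulForm (algebraMap R S ∘ x)) (altLocalize S f F) := by
  refine Ideal.map_le_iff_le_comap.mpr fun t ht => ?_
  rw [Ideal.mem_comap, mem_koszulAnnihilator, algebraMap_smul, ← map_smul]
  exact altLocalize_mem_koszulBoundaries f (mem_koszulAnnihilator.mp ht)

instance isLocalizedModule_altLocalize (T : Submonoid R) [IsLocalization T S]
    (f : M →ₗ[R] N) [IsLocalizedModule T f] : IsLocalizedModule T
    (altLocalize S f : ((Fin r → R) [⋀^Fin n]→ₗ[R] M) →ₗ[R] ((Fin r → S) [⋀^Fin n]→ₗ[S] N)) where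
  map_units s := by
    rw [← (Algebra.lsmul R R ((Fin r → S) [⋀^Fin n]→ₗ[S] N) : S →ₐ[R] _).commutes]
    exact (IsLocalization.map_units S s).map _
  surj G := by
    obtain ⟨F, s, hF⟩ := exists_compAlternatingMap_eq_smul T f (altRestrict R G)
    refine ⟨(F, s), altRestrict_injective (R := R) ?_⟩
    rw [altRestrict_altLocalize, hF, Submonoid.smul_def, Submonoid.smul_def, map_smul]
  exists_of_eq {F G} h := exists_smul_eq_of_compAlternatingMap_eq T f <| by
    rw [← altRestrict_altLocalize (S := S), h, altRestrict_altLocalize]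

theorem smul_mem_koszulBoundaries_iff {T : Submonoid R} [IsLocalization T S]
    {φ : (Fin r → S) →ₗ[S] S} (s : T) {G : (Fin r → S) [⋀^Fin n]→ₗ[S] N} :
    s • G ∈ koszulBoundaries N φ n ↔ G ∈ koszulBoundaries N φ n := by
  rw [Submonoid.smul_def, ← algebraMap_smul S (s : R) G]
  exact Submodule.smul_mem_iff_of_isUnit _ (IsLocalization.map_units S s)

theorem KoszulExactAt.localize {x : Fin r → R} (h : KoszulExactAt M (koszulForm x) n)
    (T : Submonoid R) [IsLocalization T S] (f : M →ₗ[R] N) [IsLocalizedModule T f] :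
    KoszulExactAt N (koszulForm (algebraMap R S ∘ x)) n := by
  intro G hG
  obtain ⟨⟨F, s⟩, hF⟩ := IsLocalizedModule.surj T (altLocalize S f) G
  dsimp only at hF
  have diff_eq_zero : altLocalize S f (koszulDiff (koszulForm x) n F) = 0 := by
    rw [← koszulDiff_altLocalize, ← hF, Submonoid.smul_def,
      LinearMap.map_smul_of_tower, hG, smul_zero]
  obtain ⟨t, ht⟩ := (IsLocalizedModule.eq_zero_iff T _).mp diff_eq_zero
  have boundary : t • F ∈ koszulBoundaries M (koszulForm x) n :=
    h _ (by rw [Submonoid.smul_def, map_smul, ← Submonoid.smul_def, ht])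
  rw [← smul_mem_koszulBoundaries_iff s, ← smul_mem_koszulBoundaries_iff t, hF,
    Submonoid.smul_def, ← map_smul]
  exact altLocalize_mem_koszulBoundaries f boundary

theorem exists_mem_koszulAnnihilator_of_altLocalize_mem (T : Submonoid R) [IsLocalization T S]
    (f : M →ₗ[R] N) [IsLocalizedModule T f] {x : Fin r → R}
    {F : (Fin r → R) [⋀^Fin n]→ₗ[R] M}
    (h : altLocalize S f F ∈ koszulBoundaries N (koszulForm (algebraMap R S ∘ x)) n) :
    ∃ s ∈ T, s ∈ koszulAnnihilator (koszulForm x) F := by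
  simp only [mem_koszulAnnihilator]
  cases n with
  | zero =>
    obtain ⟨s, hs⟩ := (IsLocalizedModule.eq_zero_iff T _).mp (mem_koszulBoundaries_zero.mp h)
    exact ⟨s, s.2, mem_koszulBoundaries_zero.mpr hs⟩
  | succ n =>
    obtain ⟨H, hH⟩ := h
    obtain ⟨⟨G, s⟩, hG⟩ := IsLocalizedModule.surj T (altLocalize S f) H
    dsimp only at hG
    have diff_eq : altLocalize S f (koszulDiff (koszulForm x) n G) =
        altLocalize S f ((s : R) • F) := by
      rw [← koszulDiff_altLocalize, ← hG, Submonoid.smul_def, LinearMap.map_smul_of_tower, hH,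
        map_smul]
    obtain ⟨t, ht⟩ := IsLocalizedModule.exists_of_eq (S := T) diff_eq
    refine ⟨t * s, (t * s).2, (t : R) • G, ?_⟩
    rw [map_smul, mul_smul]
    exact ht

theorem IsLeadingKoszulClass.localize {x : Fin r → R} {F : (Fin r → R) [⋀^Fin n]→ₗ[R] M}
    (hF : IsLeadingKoszulClass (koszulForm x) F) (T : Submonoid R) [IsLocalization T S]
    (f : M →ₗ[R] N) [IsLocalizedModule T f]
    (hT : ∀ s ∈ T, s ∉ koszulAnnihilator (koszulForm x) F) :
    IsLeadingKoszulClass (koszulForm (algebraMap R S ∘ x)) (altLocalize S f F) where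
  exactAt_of_lt i hi := (hF.exactAt_of_lt i hi).localize T f
  cocycle := by rw [koszulDiff_altLocalize, hF.cocycle, _root_.map_zero]
  notMem_boundaries h :=
    let ⟨s, hs, hsF⟩ := exists_mem_koszulAnnihilator_of_altLocalize_mem T f h
    hT s hs hsF

theorem koszulGradeSeq_le_localization (T : Submonoid R) [IsLocalization T S]
    (f : M →ₗ[R] N) [IsLocalizedModule T f] (x : Fin r → R) :
    koszulGradeSeq M x ≤ koszulGradeSeq N (algebraMap R S ∘ x) :=
  le_koszulGradeSeq fun _ hi => (koszulExactAt_of_lt_koszulGradeSeq hi).localize T f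

end Localization

section Kronecker

variable {R : Type*} [CommRing R] {n r : ℕ}

/-- The Krull boundary ideal of `b` modulo `I` (Coquand–Lombardi), which cuts out the boundary of
the open subset `D(b)` of `V(I)`. -/
def boundaryIdeal (I : Ideal R) (b : R) : Ideal R :=
  I ⊔ Ideal.span {b} ⊔ I.radical.colon {b}

theorem exists_mul_mem_radical_of_mem_minimalPrimes {I p : Ideal R} (hp : p ∈ I.minimalPrimes)
    {b : R} (hb : b ∈ p) : ∃ s ∉ p, s * b ∈ I.radical := by
  have : p.IsPrime := hp.isPrime
  have mem_map : algebraMap R (Localization.AtPrime p) b ∈ I.radical.map (algebraMap R _) := by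
    rw [IsLocalization.map_radical p.primeCompl,
      IsLocalization.AtPrime.radical_map_of_mem_minimalPrimes _ p I hp]
    exact Ideal.mem_map_of_mem _ hb
  exact (IsLocalization.algebraMap_mem_map_algebraMap_iff p.primeCompl _ _ _).mp mem_map

theorem notMem_minimalPrimes_of_boundaryIdeal_le {I p : Ideal R} {b : R}
    (h : boundaryIdeal I b ≤ p) : p ∉ I.minimalPrimes := by
  intro hp
  have hb : b ∈ p :=
    h (Ideal.mem_sup_left (Ideal.mem_sup_right (Ideal.mem_span_singleton_self b)))
  obtain ⟨s, hs, hsb⟩ := exists_mul_mem_radical_of_mem_minimalPrimes hp hb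
  exact hs (h (Ideal.mem_sup_right (Submodule.mem_colon_singleton.mpr hsb)))

theorem ringKrullDim_quotient_boundaryIdeal_le {I : Ideal R}
    (h : ringKrullDim (R ⧸ I) ≤ (n + 1 : ℕ)) (b : R) :
    ringKrullDim (R ⧸ boundaryIdeal I b) ≤ n := by
  rw [ringKrullDim_quotient] at h ⊢
  refine iSup_le fun c => ?_
  have le_boundary : I ≤ boundaryIdeal I b := le_sup_left.trans le_sup_left
  obtain ⟨q, hq, hqc⟩ := Ideal.exists_minimalPrimes_le (le_boundary.trans c.head.2)
  let q' : PrimeSpectrum.zeroLocus (I : Set R) := ⟨⟨q, hq.isPrime⟩, hq.le⟩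
  let c' : LTSeries (PrimeSpectrum.zeroLocus (I : Set R)) := c.map
    (Set.inclusion (PrimeSpectrum.zeroLocus_anti_mono le_boundary))
    (fun _ _ => id)
  have hlt : q' < c'.head := lt_of_le_of_ne hqc fun he =>
    notMem_minimalPrimes_of_boundaryIdeal_le c.head.2 (congr($(he).1.asIdeal) ▸ hq)
  have length_succ_le := (Order.LTSeries.length_le_krullDim (c'.cons q' hlt)).trans h
  rw [RelSeries.cons_length] at length_succ_le
  norm_cast at length_succ_le ⊢
  exact Nat.le_of_succ_le_succ length_succ_le

theorem maximalIdeal_le_radical [IsLocalRing R] {I : Ideal R} (h : ringKrullDim (R ⧸ I) ≤ 0) :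
    IsLocalRing.maximalIdeal R ≤ I.radical := by
  rw [ringKrullDim_quotient, Order.krullDim_nonpos_iff_forall_isMax] at h
  rw [Ideal.radical_eq_sInf]
  refine le_sInf fun q ⟨hIq, hq⟩ => ?_
  exact h ⟨⟨q, hq⟩, hIq⟩ (b := ⟨IsLocalRing.closedPoint R,
    hIq.trans (IsLocalRing.le_maximalIdeal hq.ne_top)⟩) (IsLocalRing.le_maximalIdeal hq.ne_top)

theorem exists_mem_radical_of_mem_radical_boundaryIdeal {I J : Ideal R} {a b : R}
    (ha : a ∈ (boundaryIdeal I b ⊔ J).radical) :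
    ∃ w, a ∈ (I ⊔ Ideal.span {b + a * w} ⊔ J).radical := by
  obtain ⟨k, hk⟩ := ha
  obtain ⟨_, hbd, v, hv, hv_eq⟩ := Submodule.mem_sup.mp hk
  obtain ⟨_, hi, w, hw, rfl⟩ := Submodule.mem_sup.mp hbd
  refine ⟨w, ?_⟩
  set K := I ⊔ Ideal.span {b + a * w} ⊔ J
  have le_K : I ≤ K.radical := (le_sup_left.trans le_sup_left).trans Ideal.le_radical
  have gen_mem : b + a * w ∈ K.radical := Ideal.le_radical <| Ideal.mem_sup_left <|
    Ideal.mem_sup_right <| Ideal.mem_span_singleton_self _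
  have hwb : w * b ∈ K.radical :=
    K.radical_isRadical.radical_le_iff.mpr le_K (Submodule.mem_colon_singleton.mp hw)
  have hb : b ∈ K.radical := by
    refine K.radical_isRadical ⟨2, ?_⟩
    have : b ^ 2 = b * (b + a * w) - a * (w * b) := by ring
    rw [this]
    exact sub_mem (Ideal.mul_mem_left _ _ gen_mem) (Ideal.mul_mem_left _ _ hwb)
  have haw : a * w ∈ K.radical := by simpa using sub_mem gen_mem hb
  have hIb : I ⊔ Ideal.span {b} ≤ K.radical :=
    sup_le le_K ((Ideal.span_singleton_le_iff_mem _).mpr hb)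
  refine K.radical_isRadical ⟨k + 1, ?_⟩
  rw [pow_succ', ← hv_eq, mul_add, mul_add]
  exact add_mem (add_mem (Ideal.mul_mem_left _ _ (hIb hi)) haw)
    (Ideal.mul_mem_left _ _ (Ideal.le_radical (Ideal.mem_sup_right hv)))

theorem exists_mem_radical_span_add_mul [IsLocalRing R] {I : Ideal R}
    (h : ringKrullDim (R ⧸ I) ≤ n) {a : R} (ha : a ∈ IsLocalRing.maximalIdeal R)
    (b : Fin n → R) :
    ∃ c : Fin n → R, a ∈ (I ⊔ Ideal.span (Set.range fun j => b j + a * c j)).radical := by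
  induction n generalizing I with
  | zero => exact ⟨0, Ideal.radical_mono le_sup_left (maximalIdeal_le_radical h ha)⟩
  | succ n ih =>
    obtain ⟨c, hc⟩ := ih (ringKrullDim_quotient_boundaryIdeal_le h (b 0)) (Fin.tail b)
    obtain ⟨w, hw⟩ := exists_mem_radical_of_mem_radical_boundaryIdeal hc
    refine ⟨Fin.cons w c, ?_⟩
    have range_eq : (Set.range fun j => b j + a * (Fin.cons w c : Fin (n + 1) → R) j) =
        insert (b 0 + a * w) (Set.range fun j => Fin.tail b j + a * c j) := by
      rw [Fin.range_fin_succ]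
      rfl
    rwa [range_eq, Ideal.span_insert, ← sup_assoc]

theorem exists_mem_radical_span_of_ringKrullDim_le [IsLocalRing R] {I : Ideal R}
    (h : ringKrullDim (R ⧸ I) ≤ n) (x : Fin r → R)
    (hx : ∀ j, x j ∈ IsLocalRing.maximalIdeal R) :
    ∃ y : Fin n → R, (∀ j, y j ∈ IsLocalRing.maximalIdeal R) ∧
      ∀ j, x j ∈ (I ⊔ Ideal.span (Set.range y)).radical := by
  induction r with
  | zero => exact ⟨0, fun _ => zero_mem _, fun j => j.elim0⟩
  | succ r ih =>
    obtain ⟨b, hb, hxb⟩ := ih (Fin.tail x) fun j => hx _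
    obtain ⟨c, hc⟩ := exists_mem_radical_span_add_mul h (hx 0) b
    set K := I ⊔ Ideal.span (Set.range fun j => b j + x 0 * c j)
    have hbK : I ⊔ Ideal.span (Set.range b) ≤ K.radical := by
      refine sup_le (le_sup_left.trans Ideal.le_radical) (Ideal.span_le.mpr ?_)
      rintro _ ⟨j, rfl⟩
      have gen_mem : b j + x 0 * c j ∈ K.radical :=
        Ideal.le_radical (Ideal.mem_sup_right (Ideal.subset_span (Set.mem_range_self j)))
      simpa using sub_mem gen_mem (Ideal.mul_mem_right (c j) _ hc)
    refine ⟨fun j => b j + x 0 * c j,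
      fun j => add_mem (hb j) (Ideal.mul_mem_right _ _ (hx 0)), Fin.cases hc fun j => ?_⟩
    exact K.radical_isRadical.radical_le_iff.mpr hbK (hxb j)

end Kronecker

section Height

variable {R : Type u} [CommRing R] {M : Type v} [AddCommGroup M] [Module R M] {r : ℕ}

theorem comap_mem_support_iff {S : Type*} [CommRing S] [Algebra R S] {N : Type*}
    [AddCommGroup N] [Module R N] [Module S N] [IsScalarTower R S N] (T : Submonoid R)
    [IsLocalization T S] (f : M →ₗ[R] N) [IsLocalizedModule T f] {Q : PrimeSpectrum S} :
    Q.comap (algebraMap R S) ∈ Module.support R M ↔ Q ∈ Module.support S N := by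
  have unit_notMem (t : T) : algebraMap R S t ∉ Q.asIdeal := fun h =>
    Q.isPrime.ne_top (Ideal.eq_top_of_isUnit_mem _ h (IsLocalization.map_units S t))
  simp only [Module.mem_support_iff']
  constructor
  · rintro ⟨m, hm⟩
    refine ⟨f m, fun z hz hzm => ?_⟩
    obtain ⟨⟨a, s⟩, hs⟩ := IsLocalization.surj T z
    have ham : f (a • m) = 0 := by
      rw [map_smul, ← algebraMap_smul S, ← hs, mul_comm, mul_smul, hzm, smul_zero]
    obtain ⟨t, ht⟩ := (IsLocalizedModule.eq_zero_iff T f).mp ham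
    refine hm (t * a) ?_ (by rw [mul_smul]; exact ht)
    change algebraMap R S (t * a) ∉ Q.asIdeal
    rw [map_mul, ← hs]
    exact Q.isPrime.mul_notMem (unit_notMem t) (Q.isPrime.mul_notMem hz (unit_notMem s))
  · rintro ⟨z, hz⟩
    obtain ⟨⟨m, s⟩, hs⟩ := IsLocalizedModule.surj T f z
    refine ⟨m, fun a ha ham => ?_⟩
    refine hz (algebraMap R S (a * s)) ?_ ?_
    · rw [map_mul]
      exact Q.isPrime.mul_notMem ha (unit_notMem s)
    · rw [algebraMap_smul, mul_smul, ← Submonoid.smul_def, hs, ← map_smul, ham, map_zero]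

/-- The contraction map `Supp M_p → Supp M`. -/
def comapSupport (M : Type v) [AddCommGroup M] [Module R M] (p : Ideal R) [p.IsPrime] :
    Module.support (Localization.AtPrime p) (LocalizedModule p.primeCompl M) →
      Module.support R M :=
  fun Q => ⟨Q.1.comap (algebraMap R (Localization.AtPrime p)),
    (comap_mem_support_iff p.primeCompl (LocalizedModule.mkLinearMap _ M)).mpr Q.2⟩

theorem comapSupport_strictMono (p : Ideal R) [p.IsPrime] : StrictMono (comapSupport M p) :=
  Monotone.strictMono_of_injective (fun _ _ h => Ideal.comap_mono h) fun _ _ h =>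
    Subtype.ext (PrimeSpectrum.localization_comap_injective _ p.primeCompl congr($(h).1))

theorem comapSupport_le (p : Module.support R M)
    (Q : Module.support (Localization.AtPrime p.1.asIdeal)
      (LocalizedModule p.1.asIdeal.primeCompl M)) :
    comapSupport M p.1.asIdeal Q ≤ p :=
  (Ideal.comap_mono (IsLocalRing.le_maximalIdeal Q.1.isPrime.ne_top)).trans
    Localization.AtPrime.under_maximalIdeal.le

theorem supportDim_localization_le_height (p : Module.support R M) :
    Module.supportDim (Localization.AtPrime p.1.asIdeal)
      (LocalizedModule p.1.asIdeal.primeCompl M) ≤ Order.height p := by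
  rw [Order.height_eq_krullDim_Iic]
  exact Order.krullDim_le_of_strictMono
    (fun Q => (⟨comapSupport M p.1.asIdeal Q, comapSupport_le p Q⟩ : Set.Iic p))
    (comapSupport_strictMono p.1.asIdeal)

theorem koszulGradeSeq_le_supportDim [IsLocalRing R] [Module.Finite R M] [Nontrivial M]
    (x : Fin r → R) (hx : ∀ j, x j ∈ IsLocalRing.maximalIdeal R) :
    (koszulGradeSeq M x : WithBot ℕ∞) ≤ Module.supportDim R M := by
  obtain ⟨d, hd⟩ := WithBot.ne_bot_iff_exists.mp (Module.supportDim_ne_bot_of_nontrivial R M)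
  rw [← hd, WithBot.coe_le_coe]
  cases d with
  | top => exact le_top
  | coe d =>
    rw [Module.supportDim_eq_ringKrullDim_quotient_annihilator] at hd
    obtain ⟨y, hy, hxy⟩ := exists_mem_radical_span_of_ringKrullDim_le hd.ge x hx
    simp only [sup_comm (Module.annihilator R M)] at hxy
    refine (koszulGradeSeq_le_of_mem_radical hxy).trans (koszulGradeSeq_le_length ?_)
    refine (Submodule.top_ne_ideal_smul_of_le_jacobson_annihilator ?_).symm
    exact (Ideal.span_le.mpr (Set.range_subset_iff.mpr hy)).trans
      (IsLocalRing.maximalIdeal_le_jacobson _)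

theorem koszulGradeSeq_le_height [Module.Finite R M] (p : Module.support R M) (x : Fin r → R)
    (hx : ∀ j, x j ∈ p.1.asIdeal) : koszulGradeSeq M x ≤ Order.height p := by
  have : Nontrivial (LocalizedModule p.1.asIdeal.primeCompl M) := Module.mem_support_iff.mp p.2
  have map_mem (j) : algebraMap R (Localization.AtPrime p.1.asIdeal) (x j) ∈
      IsLocalRing.maximalIdeal _ :=
    Localization.AtPrime.map_eq_maximalIdeal (I := p.1.asIdeal) ▸ Ideal.mem_map_of_mem _ (hx j)
  rw [← WithBot.coe_le_coe]
  calc (koszulGradeSeq M x : WithBot ℕ∞)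
    _ ≤ koszulGradeSeq (LocalizedModule p.1.asIdeal.primeCompl M) (algebraMap R _ ∘ x) :=
      WithBot.coe_le_coe.mpr <|
        koszulGradeSeq_le_localization p.1.asIdeal.primeCompl (LocalizedModule.mkLinearMap _ M) x
    _ ≤ Module.supportDim (Localization.AtPrime p.1.asIdeal) _ :=
      koszulGradeSeq_le_supportDim _ map_mem
    _ ≤ Order.height p := supportDim_localization_le_height p

theorem koszulGrade_le_moduleHeight [Module.Finite R M] (a : Ideal R) :
    koszulGrade a M ≤ moduleHeight M a :=
  iSup_le fun _ => iSup₂_le fun x hx => le_iInf₂ fun p hp =>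
    koszulGradeSeq_le_height p x fun j => hp (hx j)

theorem moduleHeight_mono {a b : Ideal R} (h : a ≤ b) : moduleHeight M a ≤ moduleHeight M b :=
  le_iInf₂ fun p hp => iInf₂_le p (h.trans hp)

theorem moduleHeight_eq_height (p : Module.support R M) :
    moduleHeight M p.1.asIdeal = Order.height p :=
  le_antisymm (iInf₂_le p le_rfl) (le_iInf₂ fun _ hq => Order.height_mono hq)

theorem moduleHeight_map_le {p q : PrimeSpectrum R} (hq : q ∈ Module.support R M)
    (hqp : q.asIdeal ≤ p.asIdeal) :
    moduleHeight (LocalizedModule p.asIdeal.primeCompl M)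
      (q.asIdeal.map (algebraMap R (Localization.AtPrime p.asIdeal))) ≤
        moduleHeight M q.asIdeal := by
  let S := Localization.AtPrime p.asIdeal
  have hdisj : Disjoint (p.asIdeal.primeCompl : Set R) q.asIdeal :=
    Set.disjoint_left.mpr fun t htp htq => htp (hqp htq)
  let Q : PrimeSpectrum S := ⟨q.asIdeal.map (algebraMap R S),
    IsLocalization.isPrime_of_isPrime_disjoint p.asIdeal.primeCompl S _ q.isPrime hdisj⟩
  have comap_eq : Q.comap (algebraMap R S) = q := PrimeSpectrum.ext
    (IsLocalization.under_map_of_isPrime_disjoint p.asIdeal.primeCompl S q.isPrime hdisj)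
  have hQ : Q ∈ Module.support S (LocalizedModule p.asIdeal.primeCompl M) :=
    (comap_mem_support_iff p.asIdeal.primeCompl (LocalizedModule.mkLinearMap _ M)).mp
      (comap_eq ▸ hq)
  calc moduleHeight (LocalizedModule p.asIdeal.primeCompl M) Q.asIdeal
    _ ≤ Order.height (⟨Q, hQ⟩ : Module.support S _) := (moduleHeight_eq_height ⟨Q, hQ⟩).le
    _ ≤ Order.height (comapSupport M p.asIdeal ⟨Q, hQ⟩) :=
      Order.height_le_height_apply_of_strictMono _ (comapSupport_strictMono p.asIdeal) _
    _ = Order.height (⟨q, hq⟩ : Module.support R M) := congr_arg _ (Subtype.ext comap_eq)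
    _ = moduleHeight M q.asIdeal := (moduleHeight_eq_height ⟨q, hq⟩).symm

end Height

section KoszulGrade

variable {R : Type u} [CommRing R] {M : Type v} [AddCommGroup M] [Module R M] {r : ℕ}

theorem koszulGradeSeq_le_koszulGrade {a : Ideal R} {x : Fin r → R} (hx : ∀ j, x j ∈ a) :
    koszulGradeSeq M x ≤ koszulGrade a M :=
  le_iSup_of_le r (le_iSup₂_of_le x hx le_rfl)

theorem koszulGrade_le {a : Ideal R} {g : ℕ∞}
    (h : ∀ (r : ℕ) (x : Fin r → R), (∀ j, x j ∈ a) → koszulGradeSeq M x ≤ g) :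
    koszulGrade a M ≤ g :=
  iSup_le fun r => iSup₂_le fun x hx => h r x hx

theorem lt_koszulGrade_iff {a : Ideal R} {g : ℕ∞} : g < koszulGrade a M ↔
    ∃ (r : ℕ) (x : Fin r → R), (∀ j, x j ∈ a) ∧ g < koszulGradeSeq M x := by
  simp only [koszulGrade, lt_iSup_iff, exists_prop]

theorem koszulGrade_mono {a b : Ideal R} (h : a ≤ b) : koszulGrade a M ≤ koszulGrade b M :=
  koszulGrade_le fun _ _ hx => koszulGradeSeq_le_koszulGrade fun j => h (hx j)

theorem koszulGrade_top : koszulGrade (⊤ : Ideal R) M = ⊤ := by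
  rw [← top_le_iff, ← koszulGradeSeq_eq_top (M := M) (x := fun _ : Fin 1 => (1 : R)) (by simp)]
  exact koszulGradeSeq_le_koszulGrade fun _ => Submodule.mem_top

theorem min_koszulGrade_le (a b : Ideal R) :
    min (koszulGrade a M) (koszulGrade b M) ≤ koszulGrade (a * b) M := by
  refine le_of_forall_lt fun g hg => ?_
  obtain ⟨r, x, hx, hgx⟩ := lt_koszulGrade_iff.mp (lt_min_iff.mp hg).1
  obtain ⟨m, y, hy, hgy⟩ := lt_koszulGrade_iff.mp (lt_min_iff.mp hg).2
  let z : Fin (r * m) → R := fun k => x (finProdFinEquiv.symm k).1 * y (finProdFinEquiv.symm k).2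
  have mul_mem_span (i j) : x i * y j ∈ Ideal.span (Set.range z) :=
    Ideal.subset_span ⟨finProdFinEquiv (i, j), by simp only [z, Equiv.symm_apply_apply]⟩
  calc g
    _ < min (koszulGradeSeq M x) (koszulGradeSeq M y) := lt_min hgx hgy
    _ ≤ koszulGradeSeq M z := min_koszulGradeSeq_le mul_mem_span
    _ ≤ koszulGrade (a * b) M :=
      koszulGradeSeq_le_koszulGrade fun _ => Ideal.mul_mem_mul (hx _) (hy _)

theorem koszulGrade_sup_annihilator_le (a : Ideal R) :
    koszulGrade (a ⊔ Module.annihilator R M) M ≤ koszulGrade a M := by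
  refine koszulGrade_le fun r x hx => ?_
  choose y hy t ht hyt using fun j => Submodule.mem_sup.mp (hx j)
  refine (koszulGradeSeq_le_of_mem_radical fun j => Ideal.le_radical ?_).trans
    (koszulGradeSeq_le_koszulGrade hy)
  rw [← hyt j]
  exact Submodule.add_mem_sup (Ideal.subset_span (Set.mem_range_self j)) (ht j)

theorem koszulGrade_sSup_le {c : Set (Ideal R)} (hc : IsChain (· ≤ ·) c) (hne : c.Nonempty)
    {g : ℕ∞} (h : ∀ b ∈ c, koszulGrade b M ≤ g) : koszulGrade (sSup c) M ≤ g := by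
  refine koszulGrade_le fun r x hx => ?_
  have hfg : (Ideal.span (Set.range x)).FG := Submodule.fg_span (Set.finite_range x)
  obtain ⟨b, hb, hle⟩ := (CompleteLattice.isCompactElement_iff_le_of_directed_sSup_le _ _).mp
    ((Submodule.fg_iff_compact _).mp hfg) c hne hc.directedOn
    (Ideal.span_le.mpr (Set.range_subset_iff.mpr hx))
  exact (koszulGradeSeq_le_koszulGrade fun j => hle (Ideal.subset_span ⟨j, rfl⟩)).trans (h b hb)

variable (M) in
theorem isOka_lt_koszulGrade {g : ℕ∞} (hg : g < ⊤) :
    Ideal.IsOka fun a : Ideal R => g < koszulGrade a M where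
  top := hg.trans_eq koszulGrade_top.symm
  oka {a t} h₁ h₂ := by
    have mul_le : (a ⊔ Ideal.span {t}) * a.colon (Ideal.span {t}) ≤ a := by
      rw [Ideal.sup_mul]
      refine sup_le Ideal.mul_le_left (Ideal.mul_le.mpr fun s hs u hu => ?_)
      rw [mul_comm]
      exact Submodule.mem_colon.mp hu s hs
    exact (lt_min h₁ h₂).trans_le ((min_koszulGrade_le _ _).trans (koszulGrade_mono mul_le))

theorem exists_mem_support_koszulGrade_le [Module.Finite R M] {a : Ideal R} {g : ℕ∞}
    (h : koszulGrade a M ≤ g) (hg : g < ⊤) :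
    ∃ p ∈ Module.support R M, a ≤ p.asIdeal ∧ koszulGrade p.asIdeal M ≤ g := by
  obtain ⟨p, hap, hp⟩ := zorn_le_nonempty₀ {b : Ideal R | koszulGrade b M ≤ g}
    (fun c hcs hc b hb => ⟨sSup c, koszulGrade_sSup_le hc ⟨b, hb⟩ hcs, fun _ hz => le_sSup hz⟩)
    a h
  have prime : p.IsPrime :=
    (isOka_lt_koszulGrade M hg).isPrime_of_maximal_not <| by
      simpa only [not_lt, Set.mem_ofPred_eq] using hp
  have annihilator_le : Module.annihilator R M ≤ p :=
    le_sup_right.trans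
      (hp.le_of_ge ((koszulGrade_sup_annihilator_le p).trans hp.prop) le_sup_left)
  exact ⟨⟨p, prime⟩, Module.mem_support_iff_of_finite.mpr annihilator_le, hap, hp.prop⟩

theorem exists_mem_support_koszulGrade_localization_le {x : Fin r → R} {g : ℕ}
    (h : koszulGradeSeq M x = g) :
    ∃ p ∈ Module.support R M, Ideal.span (Set.range x) ≤ p.asIdeal ∧
      koszulGrade (p.asIdeal.map (algebraMap R (Localization.AtPrime p.asIdeal)))
        (LocalizedModule p.asIdeal.primeCompl M) ≤ g := by
  obtain ⟨F, hF⟩ := exists_isLeadingKoszulClass h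
  obtain ⟨p, hp⟩ := Ideal.nonempty_minimalPrimes hF.koszulAnnihilator_ne_top
  have : p.IsPrime := hp.isPrime
  have hG := hF.localize (S := Localization.AtPrime p) p.primeCompl
    (LocalizedModule.mkLinearMap p.primeCompl M) fun s hs hsF => hs (hp.le hsF)
  have map_le := (IsLocalization.AtPrime.radical_map_of_mem_minimalPrimes
    (Localization.AtPrime p) p _ hp).ge.trans (Ideal.radical_mono (map_koszulAnnihilator_le
      (LocalizedModule.mkLinearMap p.primeCompl M) x F))
  exact ⟨⟨p, this⟩, hG.nontrivial, (span_le_koszulAnnihilator hF.cocycle).trans hp.le,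
    koszulGrade_le fun _ _ hy => hG.koszulGradeSeq_le fun j => map_le (hy j)⟩

theorem koszulGrade_le_koszulGrade_localization (p a : Ideal R) [p.IsPrime] :
    koszulGrade a M ≤ koszulGrade (a.map (algebraMap R (Localization.AtPrime p)))
      (LocalizedModule p.primeCompl M) :=
  koszulGrade_le fun _ x hx =>
    (koszulGradeSeq_le_localization p.primeCompl (LocalizedModule.mkLinearMap _ M) x).trans
      (koszulGradeSeq_le_koszulGrade fun j => Ideal.mem_map_of_mem _ (hx j))

end KoszulGrade

section Main

variable {R : Type u} [CommRing R] {M : Type v} [AddCommGroup M] [Module R M] [Module.Finite R M]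

theorem IsCMSpec.isCMIdeals (h : IsCMSpec R M) : IsCMIdeals R M := by
  intro a
  refine le_antisymm ?_ (koszulGrade_le_moduleHeight a)
  rcases eq_or_ne (koszulGrade a M) ⊤ with hg | hg
  · exact hg ▸ le_top
  · obtain ⟨p, hp, hap, hpg⟩ := exists_mem_support_koszulGrade_le le_rfl hg.lt_top
    rw [← h p hp] at hpg
    exact (moduleHeight_mono hap).trans hpg

theorem IsCMIdeals.isCMLocal (h : IsCMIdeals R M) : IsCMLocal R M := by
  intro p _ q hq hqp
  refine le_antisymm ?_ ?_
  · rw [h]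
    exact koszulGrade_le_koszulGrade_localization p.asIdeal q.asIdeal
  · exact (koszulGrade_le_moduleHeight _).trans (moduleHeight_map_le hq hqp)

theorem IsCMGlaz.isCMFGIdeals (h : IsCMGlaz R M) : IsCMFGIdeals R M := by
  intro a ha
  refine le_antisymm ?_ (koszulGrade_le_moduleHeight a)
  obtain ⟨r, x, rfl⟩ := Submodule.fg_iff_exists_fin_generating_family.mp ha
  refine le_trans ?_ (koszulGradeSeq_le_koszulGrade fun j => Submodule.subset_span ⟨j, rfl⟩)
  cases hg : koszulGradeSeq M x with
  | top => exact le_top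
  | coe g =>
    obtain ⟨p, hp, hxp, hpg⟩ := exists_mem_support_koszulGrade_localization_le hg
    rw [← h p hp] at hpg
    exact (moduleHeight_mono hxp).trans hpg

end Main

end

theorem theorem3p3 (R : Type u) [CommRing R] (M : Type v) [AddCommGroup M] [Module R M]
    [Module.Finite R M] :
    (IsCMSpec R M ↔ IsCMIdeals R M) ∧
    (IsCMIdeals R M → IsCMLocal R M) ∧
    (IsCMLocal R M → IsCMGlaz R M) ∧
    (IsCMGlaz R M → IsCMFGIdeals R M) :=
  ⟨⟨IsCMSpec.isCMIdeals, fun h p _ => h p.asIdeal⟩, IsCMIdeals.isCMLocal,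
    fun h p hp => h p hp p hp le_rfl, IsCMGlaz.isCMFGIdeals⟩
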